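/- Let $n\in\mathbb{N}$, $\mathcal{C}=[-1,1]^n$, let $\mathcal{H}^1$ be the one-dimensional Hausdorff measure on $\mathbb{R}^n$, and let $S\subset\mathcal{C}$ be Borel measurable and countably $1$-rectifiable, i.e. $S=\bigcup_{i=1}^\infty f_i(A_i)$ with $A_i\subset\mathbb{R}$ bounded and $f_i:A_i\to\mathbb{R}^n$ Lipschitz. Let $a\in[0,\infty]$ and let $b:S\to[0,a]$ be lower semi-continuous. For $x,y\in\mathbb{R}^n$ define the generalized urban metric $$d_{S,a,b}(x,y)=\inf_{\gamma}\left(\int_{\gamma([0,1])\cap S}b\,\mathrm{d}\mathcal{H}^1+a\,\mathcal{H}^1(\gamma([0,1])\setminus S)\right)\in[0,\infty]$$ (with $\infty\cdot 0=0$), where the infimum is over all Lipschitz paths $\gamma:[0,1]\to\mathbb{R}^n$ with $\gamma(0)=x$ and $\gamma(1)=y$. Let $\mu_+,\mu_-$ be Borel probability measures on $\mathbb{R}^n$ supported in $\mathcal{C}$, let $\Pi(\mu_+,\mu_-)$ be the set of transport plans, i.e. of Borel probability measures on $\mathbb{R}^n\times\mathbb{R}^n$ with first marginal $\mu_+$ and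 second marginal $\mu_-$, and let $$W_{d_{S,a,b}}(\mu_+,\mu_-)=\inf_{\pi\in\Pi(\mu_+,\mu_-)}\int_{\mathbb{R}^n\times\mathbb{R}^n}d_{S,a,b}\,\mathrm{d}\pi\in[0,\infty].$$ **Proposition (Existence of optimal transport plan).** Assume that $a<\infty$, or that $\mathcal{H}^1(\{z\in S : b(z)\le\lambda\})<\infty$ for all $\lambda\in[0,a)$. Then there exists a transport plan $\pi\in\Pi(\mu_+,\mu_-)$ such that $$W_{d_{S,a,b}}(\mu_+,\mu_-)=\int_{\mathbb{R}^n\times\mathbb{R}^n}d_{S,a,b}(x,y)\,\mathrm{d}\pi(x,y).$$ -/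

import Mathlib

open MeasureTheory Set
open scoped ENNReal

noncomputable section

namespace UrbanPlanning

/-- `ℝⁿ` with the Euclidean norm. -/
abbrev E (n : ℕ) : Type := EuclideanSpace ℝ (Fin n)

/-- The hypercube `[-1, 1]ⁿ`. -/
def hypercube (n : ℕ) : Set (E n) := {x | ∀ i, x i ∈ Icc (-1 : ℝ) 1}

/-- One-dimensional Hausdorff measure on `ℝⁿ`. -/
abbrev H1 (n : ℕ) : Measure (E n) := Measure.hausdorffMeasure 1

/-- `S` is a countable union of images `fᵢ(Aᵢ)` with `Aᵢ ⊆ ℝ` bounded and `fᵢ` Lipschitz on `Aᵢ`. -/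
def CountablyOneRectifiable {n : ℕ} (S : Set (E n)) : Prop :=
  ∃ (A : ℕ → Set ℝ) (f : ℕ → ℝ → E n),
    (∀ i, Bornology.IsBounded (A i) ∧ ∃ K, LipschitzOnWith K (f i) (A i)) ∧
      S = ⋃ i, f i '' A i

/-- The set `Γ^{xy}` of Lipschitz paths `γ : [0, 1] → ℝⁿ` with `γ 0 = x` and `γ 1 = y`. -/
def lipschitzPaths {n : ℕ} (x y : E n) : Set (unitInterval → E n) :=
  {γ | (∃ K, LipschitzWith K γ) ∧ γ 0 = x ∧ γ 1 = y}

/-- The cost `∫_{γ([0,1]) ∩ S} b dℋ¹ + a ℋ¹(γ([0,1]) \ S)` of a path;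
only the values of `b` on `S` enter. -/
def pathCost {n : ℕ} (S : Set (E n)) (a : ℝ≥0∞) (b : E n → ℝ≥0∞) (γ : unitInterval → E n) :
    ℝ≥0∞ :=
  (∫⁻ z in range γ ∩ S, b z ∂(H1 n)) + a * H1 n (range γ \ S)

/-- The generalized urban metric `d_{S,a,b}`. -/
def urbanMetric {n : ℕ} (S : Set (E n)) (a : ℝ≥0∞) (b : E n → ℝ≥0∞) (x y : E n) : ℝ≥0∞ :=
  ⨅ γ ∈ lipschitzPaths x y, pathCost S a b γ

/-- The set `Π(μ, ν)` of transport plans. -/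
def transportPlans {n : ℕ} (μ ν : Measure (E n)) : Set (Measure (E n × E n)) :=
  {π | IsProbabilityMeasure π ∧ π.fst = μ ∧ π.snd = ν}

/-- The total travel cost `∫ d_{S,a,b} dπ`. -/
def transportCost {n : ℕ} (S : Set (E n)) (a : ℝ≥0∞) (b : E n → ℝ≥0∞)
    (π : Measure (E n × E n)) : ℝ≥0∞ :=
  ∫⁻ p, urbanMetric S a b p.1 p.2 ∂π

/-- The Wasserstein distance `W_{d_{S,a,b}}(μ, ν)`. -/
def wassersteinDist {n : ℕ} (S : Set (E n)) (a : ℝ≥0∞) (b : E n → ℝ≥0∞)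
    (μ ν : Measure (E n)) : ℝ≥0∞ :=
  ⨅ π ∈ transportPlans μ ν, transportCost S a b π

/-- The part `S_λ = {z ∈ S | b z ≤ λ}` of the network. -/
def subNetwork {n : ℕ} (S : Set (E n)) (b : E n → ℝ≥0∞) (l : ℝ≥0∞) : Set (E n) :=
  {z ∈ S | b z ≤ l}

end UrbanPlanning

end

/-!
Write `w` for the cost density: `b` on the network and `a` off it. The urban metric is then the
infimum of `∫ w dℋ¹` over the images of Lipschitz curves with given endpoints. It is lower
semicontinuous, so Prokhorov's theorem and the portmanteau theorem give an optimal plan.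

If `a < ∞`, the urban metric is even continuous, because it satisfies the triangle inequality and is
dominated by `a` times the Euclidean distance.

If `a = ∞`, choose among the curves with the same endpoints inside the image of a given one a curve
`σ` with the smallest Lipschitz constant `m`. For `m > 0` it is injective: cutting out a loop lowers
the constant; running through its image by arc length, whose constant is the length of the image,
shows `m ≤ ℋ¹(image σ)`. Hence curves of bounded cost can be chosen with Lipschitz constant at most
`ℋ¹{w ≤ 1} + ∫ w dℋ¹`, so Arzelà–Ascoli applies to them. For such curves
`ℋ¹(σ '' B) = m * volume B`, so Fatou's lemma in the parameter interval gives Gołąb's theorem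
(lower semicontinuity of length) inside every open set. Since `{w ≤ l}` has finite measure, it is
approximated from within by closed sets, so the same holds inside `{w > l}`. The layer cake formula
and Fatou's lemma in `l` then give lower semicontinuity of the cost.
-/

open Filter Topology
open scoped NNReal

namespace UrbanPlanning

section LipschitzMaps

variable {X Y : Type*} [MetricSpace X]

lemma lipschitzWith_of_tendsto [PseudoMetricSpace Y] {ι : Type*} {u : Filter ι} [u.NeBot]
    {M : ι → ℝ≥0} {m : ℝ≥0} {f : ι → Y → X} {g : Y → X} (hf : ∀ k, LipschitzWith (M k) (f k))
    (hM : Tendsto M u (𝓝 m)) (hg : ∀ t, Tendsto (fun k => f k t) u (𝓝 (g t))) :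
    LipschitzWith m g :=
  LipschitzWith.of_dist_le_mul fun s t =>
    le_of_tendsto_of_tendsto' ((hg s).dist (hg t))
      (((NNReal.continuous_coe.tendsto m).comp hM).mul_const (dist s t))
      fun k => (hf k).dist_le_mul s t

lemma exists_subseq_tendsto_of_lipschitzWith [PseudoMetricSpace Y] [CompactSpace Y] {M : ℝ≥0}
    {K : Set X} (hK : IsCompact K) {m : ℕ → ℝ≥0} (hm : ∀ k, m k ≤ M) {f : ℕ → Y → X}
    (hf : ∀ k, LipschitzWith (m k) (f k)) (hfK : ∀ k t, f k t ∈ K) :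
    ∃ (r : ℝ≥0) (g : Y → X) (φ : ℕ → ℕ), StrictMono φ ∧ Tendsto (m ∘ φ) atTop (𝓝 r) ∧
      ∀ t, Tendsto (fun k => f (φ k) t) atTop (𝓝 (g t)) := by
  obtain ⟨r, -, ψ, hψ, hr⟩ := isCompact_Icc.tendsto_subseq (x := m) fun k => ⟨zero_le, hm k⟩
  let A : Set (BoundedContinuousFunction Y X) := {h | LipschitzWith M h ∧ ∀ t, h t ∈ K}
  have hA : IsCompact (closure A) :=
    BoundedContinuousFunction.arzela_ascoli K hK A (fun h t hh => hh.2 t)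
      (LipschitzWith.uniformEquicontinuous (fun h : A => (h.1 : Y → X)) M
        fun h => h.2.1).equicontinuous
  let F (k : ℕ) : BoundedContinuousFunction Y X :=
    BoundedContinuousFunction.mkOfCompact ⟨f (ψ k), (hf (ψ k)).continuous⟩
  obtain ⟨g, -, φ, hφ, hg⟩ := hA.tendsto_subseq (x := F)
    fun k => subset_closure ⟨(hf (ψ k)).weaken (hm (ψ k)), hfK (ψ k)⟩
  exact ⟨r, g, ψ ∘ φ, hψ.comp hφ, hr.comp hφ.tendsto_atTop,
    (BoundedContinuousFunction.tendsto_iff_tendstoUniformly.1 hg).tendsto_at⟩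

lemma exists_subseq_tendsto_of_lipschitzWith_of_tendsto [ProperSpace X] [PseudoMetricSpace Y]
    [CompactSpace Y] {M : ℝ≥0} {m : ℕ → ℝ≥0} (hm : ∀ k, m k ≤ M) {f : ℕ → Y → X}
    (hf : ∀ k, LipschitzWith (m k) (f k)) {t₀ : Y} {x₀ : X}
    (hx₀ : Tendsto (fun k => f k t₀) atTop (𝓝 x₀)) :
    ∃ (r : ℝ≥0) (g : Y → X) (φ : ℕ → ℕ), StrictMono φ ∧ Tendsto (m ∘ φ) atTop (𝓝 r) ∧
      ∀ t, Tendsto (fun k => f (φ k) t) atTop (𝓝 (g t)) := by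
  let δ : ℝ := M * Metric.diam (univ : Set Y)
  have hK : IsCompact (Metric.cthickening δ (insert x₀ (range fun k => f k t₀))) :=
    hx₀.isCompact_insert_range.cthickening
  refine exists_subseq_tendsto_of_lipschitzWith hK hm hf fun k t => ?_
  refine Metric.mem_cthickening_of_dist_le _ (f k t₀) _ _ (Or.inr ⟨k, rfl⟩) ?_
  calc dist (f k t) (f k t₀) ≤ m k * dist t t₀ := (hf k).dist_le_mul t t₀
    _ ≤ M * Metric.diam (univ : Set Y) := by
        gcongr
        · exact hm k
        · exact Metric.dist_le_diam_of_mem isCompact_univ.isBounded (mem_univ t) (mem_univ t₀)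

lemma lipschitzWith_ite_le {f g : ℝ → X} {m : ℝ≥0} (hf : LipschitzWith m f)
    (hg : LipschitzWith m g) {c : ℝ} (hc : f c = g c) :
    LipschitzWith m fun u => if u ≤ c then f u else g u := by
  refine LipschitzWith.of_dist_le_mul fun u v => ?_
  wlog huv : u ≤ v generalizing u v
  · rw [dist_comm, dist_comm u]
    exact this v u (le_of_not_ge huv)
  by_cases hv : v ≤ c
  · simpa only [huv.trans hv, hv, if_true] using hf.dist_le_mul u v
  by_cases hu : u ≤ c
  · simp only [hu, hv, if_true, if_false]
    calc dist (f u) (g v) ≤ dist (f u) (f c) + dist (g c) (g v) := hc ▸ dist_triangle _ _ _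
      _ ≤ m * dist u c + m * dist c v := add_le_add (hf.dist_le_mul u c) (hg.dist_le_mul c v)
      _ = m * dist u v := by
        rw [← mul_add, dist_add_dist_of_mem_segment]
        exact segment_eq_Icc huv ▸ ⟨hu, (not_le.1 hv).le⟩
  · simpa only [hu, hv, if_false] using hg.dist_le_mul u v

lemma lipschitzWith_iccExtend {a b : ℝ} (hab : a ≤ b) {σ : Icc a b → X} {m : ℝ≥0}
    (hσ : LipschitzWith m σ) : LipschitzWith m (IccExtend hab σ) := by
  simpa only [mul_one] using! hσ.comp (LipschitzWith.projIcc hab)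

lemma lipschitzWith_comp_mul_coe {f : ℝ → X} {m : ℝ≥0} (hf : LipschitzWith m f) (l : ℝ≥0) :
    LipschitzWith (m * l) fun u : unitInterval => f (l * u) := by
  have hl : LipschitzWith l fun u : unitInterval => (l * u : ℝ) := by
    simpa using! (lipschitzWith_smul (l : ℝ)).comp (LipschitzWith.subtype_val (· ∈ unitInterval))
  exact hf.comp hl

end LipschitzMaps

/-- `σ` has the endpoints of `γ` and runs inside the image of `γ`, in any order and at any
speed. -/
structure IsSubcurve {X : Type*} (σ γ : unitInterval → X) : Prop where
  map_zero : σ 0 = γ 0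
  map_one : σ 1 = γ 1
  range_subset : range σ ⊆ range γ

lemma IsSubcurve.trans {X : Type*} {γ σ τ : unitInterval → X} (hτ : IsSubcurve τ σ)
    (hσ : IsSubcurve σ γ) : IsSubcurve τ γ :=
  ⟨hτ.map_zero.trans hσ.map_zero, hτ.map_one.trans hσ.map_one,
    hτ.range_subset.trans hσ.range_subset⟩

section Excision

variable {X : Type*} [MetricSpace X]

lemma exists_isSubcurve_excise_loop {σ : unitInterval → X} {m : ℝ≥0} (hσ : LipschitzWith m σ)
    {s t : unitInterval} (h : σ s = σ t) :
    ∃ τ, IsSubcurve τ σ ∧ LipschitzWith (m * (1 - nndist s t)) τ := by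
  wlog hst : s ≤ t generalizing s t
  · rw [nndist_comm]
    exact this h.symm (le_of_not_ge hst)
  have hdist : (nndist s t : ℝ) = t - s := by
    rw [coe_nndist, dist_comm, Subtype.dist_eq, Real.dist_eq,
      abs_of_nonneg (sub_nonneg.2 (show (s : ℝ) ≤ t from hst))]
  set l : ℝ≥0 := nndist s t
  have hl : ((1 - l : ℝ≥0) : ℝ) = 1 - l := NNReal.coe_sub (by
    rw [← NNReal.coe_le_coe, hdist, NNReal.coe_one]; linarith [s.2.1, t.2.2])
  set F : ℝ → X := IccExtend zero_le_one σ
  have hF : LipschitzWith m F := lipschitzWith_iccExtend zero_le_one hσ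
  have hFσ (u : unitInterval) : F u = σ u := IccExtend_val _ _ _
  have hFrange (r : ℝ) : F r ∈ range σ := ⟨projIcc 0 1 zero_le_one r, rfl⟩
  set G : ℝ → X := fun w => if w ≤ s then F w else F (w + l)
  have hGleft {w : ℝ} (hw : w ≤ s) : G w = F w := if_pos hw
  have hGright {w : ℝ} (hw : s ≤ w) : G w = F (w + l) := by
    rcases hw.eq_or_lt with rfl | hw
    · rw [hGleft le_rfl, hdist, add_sub_cancel, hFσ, hFσ, h]
    · exact if_neg hw.not_ge
  have hG : LipschitzWith m G := lipschitzWith_ite_le hF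
    (by simpa only [mul_one] using! hF.comp (isometry_add_right (l : ℝ)).lipschitz)
    ((hGleft le_rfl).symm.trans (hGright le_rfl))
  refine ⟨_, ⟨?_, ?_, ?_⟩, lipschitzWith_comp_mul_coe hG (1 - l)⟩
  · simpa only [Icc.coe_zero, mul_zero, hGleft s.2.1] using hFσ 0
  · have h1 : (s : ℝ) ≤ 1 - l := by linarith [t.2.2]
    simpa only [Icc.coe_one, mul_one, hl, hGright h1, sub_add_cancel] using hFσ 1
  · rintro _ ⟨u, rfl⟩
    simp only [G]
    split_ifs <;> exact hFrange _

lemma exists_lipschitzWith_concat {σ τ : unitInterval → X} {K L : ℝ≥0} (hσ : LipschitzWith K σ)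
    (hτ : LipschitzWith L τ) (h : σ 1 = τ 0) :
    ∃ (ρ : unitInterval → X) (M : ℝ≥0), LipschitzWith M ρ ∧ ρ 0 = σ 0 ∧ ρ 1 = τ 1 ∧
      range ρ ⊆ range σ ∪ range τ := by
  set F : ℝ → X := IccExtend zero_le_one σ
  set H : ℝ → X := fun w => IccExtend zero_le_one τ (w - 1)
  have hF : LipschitzWith (max K L) F :=
    (lipschitzWith_iccExtend zero_le_one hσ).weaken (le_max_left _ _)
  have hH : LipschitzWith (max K L) H := by
    simpa only [mul_one, sub_eq_add_neg] using! ((lipschitzWith_iccExtend zero_le_one hτ).weaken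
      (le_max_right K L)).comp (isometry_add_right (-1 : ℝ)).lipschitz
  have hFH : F 1 = H 1 := by simpa [F, H] using h
  refine ⟨_, _, lipschitzWith_comp_mul_coe (lipschitzWith_ite_le hF hH hFH) 2, ?_, ?_, ?_⟩
  · simp [F]
  · norm_num [H]
  · rintro _ ⟨u, rfl⟩
    dsimp only
    split_ifs
    exacts [Or.inl ⟨_, rfl⟩, Or.inr ⟨_, rfl⟩]

end Excision

/-- An `m`-Lipschitz curve is taut if no curve with the same endpoints inside its image has a
smaller Lipschitz constant. -/
structure IsTaut {X : Type*} [MetricSpace X] (m : ℝ≥0) (σ : unitInterval → X) : Prop where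
  lipschitzWith : LipschitzWith m σ
  le_of_isSubcurve : ∀ ⦃m' τ⦄, IsSubcurve τ σ → LipschitzWith m' τ → m ≤ m'

section Taut

variable {X : Type*} [MetricSpace X]

lemma exists_isSubcurve_isTaut {γ : unitInterval → X} {K : ℝ≥0} (hγ : LipschitzWith K γ) :
    ∃ σ m, IsSubcurve σ γ ∧ IsTaut m σ := by
  let C : Set ℝ≥0 := {m | ∃ τ, IsSubcurve τ γ ∧ LipschitzWith m τ}
  have hC : BddBelow C := OrderBot.bddBelow C
  obtain ⟨m, hm_anti, hm_lim, hmC⟩ :=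
    exists_seq_tendsto_sInf (S := C) ⟨K, γ, ⟨rfl, rfl, Subset.rfl⟩, hγ⟩ hC
  choose τ hτγ hτ using hmC
  have hrange : IsCompact (range γ) := isCompact_range hγ.continuous
  obtain ⟨r, σ, φ, hφ, hr, hσ⟩ := exists_subseq_tendsto_of_lipschitzWith hrange
    (fun k => hm_anti (Nat.zero_le k)) hτ fun k t => (hτγ k).range_subset (mem_range_self t)
  obtain rfl : r = sInf C := tendsto_nhds_unique hr (hm_lim.comp hφ.tendsto_atTop)
  have hσγ : IsSubcurve σ γ :=
    ⟨tendsto_nhds_unique (hσ 0) (by simp only [(hτγ _).map_zero, tendsto_const_nhds]),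
      tendsto_nhds_unique (hσ 1) (by simp only [(hτγ _).map_one, tendsto_const_nhds]),
      range_subset_iff.2 fun t => hrange.isClosed.mem_of_tendsto (hσ t) <|
        .of_forall fun k => (hτγ (φ k)).range_subset (mem_range_self t)⟩
  exact ⟨σ, sInf C, hσγ, lipschitzWith_of_tendsto (fun k => hτ (φ k)) hr hσ,
    fun m' τ' hτ' hL => csInf_le hC ⟨τ', hτ'.trans hσγ, hL⟩⟩

lemma IsTaut.injective {σ : unitInterval → X} {m : ℝ≥0} (hσ : IsTaut m σ) (hm : m ≠ 0) :
    Function.Injective σ := by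
  intro s t hst
  obtain ⟨τ, hτ, hL⟩ := exists_isSubcurve_excise_loop hσ.lipschitzWith hst
  by_contra hne
  have hlt : 1 - nndist s t < 1 :=
    tsub_lt_self one_pos (pos_iff_ne_zero.2 (nndist_eq_zero.not.2 hne))
  exact (mul_lt_of_lt_one_right (pos_iff_ne_zero.2 hm) hlt).not_ge (hσ.le_of_isSubcurve hτ hL)

end Taut

section HausdorffLength

variable {X : Type*} [MetricSpace X] [MeasurableSpace X] [BorelSpace X]

lemma edist_le_hausdorffMeasure_of_isPreconnected {C : Set X} (hC : IsPreconnected C) {x y : X}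
    (hx : x ∈ C) (hy : y ∈ C) : edist x y ≤ μH[1] C := by
  have hL : LipschitzWith 1 (dist x) := LipschitzWith.dist_right x
  have hsub : Icc 0 (dist x y) ⊆ dist x '' C :=
    (hC.image _ hL.continuous.continuousOn).ordConnected.out ⟨x, hx, dist_self x⟩ ⟨y, hy, rfl⟩
  calc edist x y = μH[1] (Icc 0 (dist x y)) := by
        rw [hausdorffMeasure_real, Real.volume_Icc, sub_zero, edist_dist]
    _ ≤ μH[1] (dist x '' C) := measure_mono hsub
    _ ≤ μH[1] C := by simpa using hL.hausdorffMeasure_image_le zero_le_one C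

lemma hausdorffMeasure_unitInterval : (μH[1] : Measure unitInterval) = volume := by
  ext B -
  rw [unitInterval.volume_apply, ← hausdorffMeasure_real,
    isometry_subtype_coe.hausdorffMeasure_image (Or.inl zero_le_one)]

lemma hausdorffMeasure_image_le_mul_volume {σ : unitInterval → X} {m : ℝ≥0}
    (hσ : LipschitzWith m σ) (B : Set unitInterval) : μH[1] (σ '' B) ≤ m * volume B := by
  simpa [hausdorffMeasure_unitInterval] using hσ.hausdorffMeasure_image_le zero_le_one B

lemma hausdorffMeasure_range_le {σ : unitInterval → X} {m : ℝ≥0} (hσ : LipschitzWith m σ) :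
    μH[1] (range σ) ≤ m := by
  simpa using hausdorffMeasure_image_le_mul_volume hσ univ

lemma hausdorffMeasure_image_ne_top {σ : unitInterval → X} {m : ℝ≥0} (hσ : LipschitzWith m σ)
    (B : Set unitInterval) : μH[1] (σ '' B) ≠ ∞ :=
  ((hausdorffMeasure_image_le_mul_volume hσ B).trans_lt (by finiteness)).ne

lemma isFiniteMeasure_restrict_range {σ : unitInterval → X} {m : ℝ≥0} (hσ : LipschitzWith m σ) :
    IsFiniteMeasure (μH[1].restrict (range σ)) :=
  isFiniteMeasure_restrict.2 (image_univ ▸ hausdorffMeasure_image_ne_top hσ univ)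

/-- The length of the part of the image of `σ` traced up to time `t`. It is the arc length of `σ`
up to `t` when `σ` is injective, and takes the junk value `0` when that part is infinitely long. -/
noncomputable def arcLength (σ : unitInterval → X) (t : unitInterval) : ℝ :=
  μH[1].real (σ '' Iic t)

section ArcLength

variable {σ : unitInterval → X} {m : ℝ≥0}

lemma dist_arcLength (hσ : LipschitzWith m σ) (hinj : Function.Injective σ) (s t : unitInterval) :
    dist (arcLength σ s) (arcLength σ t) = μH[1].real (σ '' uIcc s t) := by
  wlog hst : s ≤ t generalizing s t
  · rw [dist_comm, uIcc_comm]
    exact this t s (le_of_not_ge hst)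
  have hmeas : MeasurableSet (σ '' Icc s t) := (isCompact_Icc.image hσ.continuous).measurableSet
  have hinter : μH[1] (σ '' Iic s ∩ σ '' Icc s t) = 0 := by
    have := Measure.nullSingletonClass_hausdorff X one_pos
    rw [← image_inter hinj, ← Ici_inter_Iic, ← inter_assoc, Iic_inter_Ici, Icc_self,
      singleton_inter_of_mem (mem_Iic.2 hst), image_singleton, measure_singleton]
  have hadd : arcLength σ t = arcLength σ s + μH[1].real (σ '' Icc s t) := by
    rw [arcLength, ← Iic_union_Icc_eq_Iic hst, image_union]
    exact measureReal_union₀ hmeas.nullMeasurableSet hinter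
      (hausdorffMeasure_image_ne_top hσ _) (hausdorffMeasure_image_ne_top hσ _)
  rw [hadd, dist_self_add_right, Real.norm_of_nonneg measureReal_nonneg, uIcc_of_le hst]

lemma dist_le_dist_arcLength (hσ : LipschitzWith m σ) (hinj : Function.Injective σ)
    (s t : unitInterval) : dist (σ s) (σ t) ≤ dist (arcLength σ s) (arcLength σ t) := by
  rw [dist_arcLength hσ hinj, dist_edist]
  exact ENNReal.toReal_mono (hausdorffMeasure_image_ne_top hσ _) <|
    edist_le_hausdorffMeasure_of_isPreconnected
      (isPreconnected_uIcc.image σ hσ.continuous.continuousOn)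
      (mem_image_of_mem σ left_mem_uIcc) (mem_image_of_mem σ right_mem_uIcc)

lemma lipschitzWith_arcLength (hσ : LipschitzWith m σ) (hinj : Function.Injective σ) :
    LipschitzWith m (arcLength σ) := by
  refine LipschitzWith.of_dist_le_mul fun s t => ?_
  rw [dist_arcLength hσ hinj, dist_comm, dist_edist, ← unitInterval.volume_uIcc,
    ← ENNReal.coe_toReal, ← ENNReal.toReal_mul]
  exact ENNReal.toReal_mono (by finiteness) (hausdorffMeasure_image_le_mul_volume hσ _)

lemma nndist_arcLength_zero_one (hσ : LipschitzWith m σ) (hinj : Function.Injective σ) :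
    nndist (arcLength σ 0) (arcLength σ 1) = μH[1] (range σ) := by
  have huniv : uIcc (0 : unitInterval) 1 = univ := by
    rw [uIcc_of_le zero_le_one, ← unitInterval.univ_eq_Icc]
  rw [← edist_nndist, edist_dist, dist_arcLength hσ hinj, huniv,
    ofReal_measureReal (hausdorffMeasure_image_ne_top hσ univ), image_univ]

end ArcLength

lemma exists_isSubcurve_lipschitzWith_of_dist_le {Y : Type*} [MetricSpace Y] {σ : unitInterval → Y}
    {V : unitInterval → ℝ} (hV : Continuous V)
    (h : ∀ s t, dist (σ s) (σ t) ≤ dist (V s) (V t)) :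
    ∃ τ, IsSubcurve τ σ ∧ LipschitzWith (nndist (V 0) (V 1)) τ := by
  have hsurj (u : unitInterval) : ∃ r, V r = AffineMap.lineMap (V 0) (V 1) (u : ℝ) := by
    have hu : AffineMap.lineMap (V 0) (V 1) (u : ℝ) ∈ uIcc (V 0) (V 1) := by
      rw [← segment_eq_uIcc, segment_eq_image_lineMap]
      exact mem_image_of_mem _ u.2
    obtain ⟨r, -, hr⟩ := intermediate_value_uIcc hV.continuousOn hu
    exact ⟨r, hr⟩
  choose r hr using hsurj
  have heq {u t : unitInterval} (hut : V (r u) = V t) : σ (r u) = σ t :=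
    dist_le_zero.1 ((h (r u) t).trans_eq (by rw [hut, dist_self]))
  refine ⟨σ ∘ r, ⟨heq (by simp [hr]), heq (by simp [hr]), range_comp_subset_range r σ⟩, ?_⟩
  refine LipschitzWith.of_dist_le_mul fun u v => (h (r u) (r v)).trans_eq ?_
  rw [hr, hr, dist_lineMap_lineMap, mul_comm, coe_nndist, Subtype.dist_eq]

/-- `σ` is `m`-Lipschitz and its image is at least `m` long, hence exactly `m` long: `σ` runs
through its image at speed `m`, essentially without visiting any part of it twice. -/
structure IsConstantSpeed (m : ℝ≥0) (σ : unitInterval → X) : Prop where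
  lipschitzWith : LipschitzWith m σ
  le_hausdorffMeasure : m ≤ μH[1] (range σ)

lemma IsConstantSpeed.hausdorffMeasure_image {σ : unitInterval → X} {m : ℝ≥0}
    (hσ : IsConstantSpeed m σ) {B : Set unitInterval} (hB : MeasurableSet B) :
    μH[1] (σ '' B) = m * volume B := by
  refine le_antisymm (hausdorffMeasure_image_le_mul_volume hσ.lipschitzWith B) ?_
  have hfin : (m : ℝ≥0∞) * volume Bᶜ ≠ ∞ := by finiteness
  refine (ENNReal.add_le_add_iff_right hfin).1 ?_
  calc (m : ℝ≥0∞) * volume B + m * volume Bᶜ = m := by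
        rw [← mul_add, measure_add_measure_compl hB, measure_univ, mul_one]
    _ ≤ μH[1] (range σ) := hσ.le_hausdorffMeasure
    _ = μH[1] (σ '' B ∪ σ '' Bᶜ) := by rw [← image_union, union_compl_self, image_univ]
    _ ≤ μH[1] (σ '' B) + μH[1] (σ '' Bᶜ) := measure_union_le _ _
    _ ≤ μH[1] (σ '' B) + m * volume Bᶜ := by
        gcongr
        exact hausdorffMeasure_image_le_mul_volume hσ.lipschitzWith Bᶜ

lemma IsTaut.isConstantSpeed {σ : unitInterval → X} {m : ℝ≥0} (hσ : IsTaut m σ) :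
    IsConstantSpeed m σ := by
  refine ⟨hσ.lipschitzWith, ?_⟩
  rcases eq_or_ne m 0 with rfl | hm
  · exact zero_le
  have hinj := hσ.injective hm
  obtain ⟨τ, hτ, hL⟩ := exists_isSubcurve_lipschitzWith_of_dist_le
    (lipschitzWith_arcLength hσ.lipschitzWith hinj).continuous
    (dist_le_dist_arcLength hσ.lipschitzWith hinj)
  rw [← nndist_arcLength_zero_one hσ.lipschitzWith hinj]
  exact ENNReal.coe_le_coe.2 (hσ.le_of_isSubcurve hτ hL)

lemma exists_isSubcurve_isConstantSpeed {γ : unitInterval → X} {K : ℝ≥0}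
    (hγ : LipschitzWith K γ) : ∃ σ m, IsSubcurve σ γ ∧ IsConstantSpeed m σ := by
  obtain ⟨σ, m, hσγ, hσ⟩ := exists_isSubcurve_isTaut hγ
  exact ⟨σ, m, hσγ, hσ.isConstantSpeed⟩

end HausdorffLength

section LowerSemicontinuityOfLength

variable {X ι : Type*} [MetricSpace X] [MeasurableSpace X] [BorelSpace X] {u : Filter ι}
  [u.NeBot] [u.IsCountablyGenerated] {m : ι → ℝ≥0} {σ : ι → unitInterval → X} {r : ℝ≥0}
  {γ : unitInterval → X}

lemma hausdorffMeasure_range_inter_le_liminf (hσ : ∀ k, IsConstantSpeed (m k) (σ k))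
    (hm : Tendsto m u (𝓝 r)) (hγ : ∀ t, Tendsto (fun k => σ k t) u (𝓝 (γ t))) {U : Set X}
    (hU : IsOpen U) :
    μH[1] (range γ ∩ U) ≤ liminf (fun k => μH[1] (range (σ k) ∩ U)) u := by
  have hγL : LipschitzWith r γ := lipschitzWith_of_tendsto (fun k => (hσ k).lipschitzWith) hm hγ
  have hmeas (k : ι) : MeasurableSet (σ k ⁻¹' U) :=
    (hU.preimage (hσ k).lipschitzWith.continuous).measurableSet
  let speed (m : ℝ≥0) (σ : unitInterval → X) : unitInterval → ℝ≥0∞ :=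
    (σ ⁻¹' U).indicator fun _ => m
  have hspeed (t : unitInterval) : speed r γ t ≤ liminf (fun k => speed (m k) (σ k) t) u := by
    by_cases ht : γ t ∈ U
    · have hev : ∀ᶠ k in u, (m k : ℝ≥0∞) = speed (m k) (σ k) t := by
        filter_upwards [(hγ t).eventually (hU.mem_nhds ht)] with k hk
        exact (indicator_of_mem (s := σ k ⁻¹' U) hk fun _ => (m k : ℝ≥0∞)).symm
      have hlim := (ENNReal.tendsto_coe.2 hm).congr' hev
      exact (indicator_of_mem (s := γ ⁻¹' U) ht fun _ => (r : ℝ≥0∞)).trans_le hlim.liminf_eq.ge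
    · exact (indicator_of_notMem (s := γ ⁻¹' U) ht fun _ => (r : ℝ≥0∞)).trans_le zero_le
  calc μH[1] (range γ ∩ U) = μH[1] (γ '' (γ ⁻¹' U)) := by rw [image_preimage_eq_range_inter]
    _ ≤ r * volume (γ ⁻¹' U) := hausdorffMeasure_image_le_mul_volume hγL _
    _ = ∫⁻ t, speed r γ t :=
        (lintegral_indicator_const (hU.preimage hγL.continuous).measurableSet _).symm
    _ ≤ ∫⁻ t, liminf (fun k => speed (m k) (σ k) t) u := lintegral_mono hspeed
    _ ≤ liminf (fun k => ∫⁻ t, speed (m k) (σ k) t) u :=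
        lintegral_liminf_le fun k => measurable_const.indicator (hmeas k)
    _ = liminf (fun k => μH[1] (range (σ k) ∩ U)) u := by
        simp only [speed, lintegral_indicator_const (hmeas _),
          ← (hσ _).hausdorffMeasure_image (hmeas _), image_preimage_eq_range_inter]

lemma hausdorffMeasure_range_sdiff_le_liminf (hσ : ∀ k, IsConstantSpeed (m k) (σ k))
    (hm : Tendsto m u (𝓝 r)) (hγ : ∀ t, Tendsto (fun k => σ k t) u (𝓝 (γ t))) {A : Set X}
    (hA : MeasurableSet A) (hfin : μH[1] A < ∞) :
    μH[1] (range γ \ A) ≤ liminf (fun k => μH[1] (range (σ k) \ A)) u := by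
  refine ENNReal.le_of_forall_pos_le_add fun ε hε _ => ?_
  have : IsFiniteMeasure (μH[1].restrict A : Measure X) := isFiniteMeasure_restrict.2 hfin.ne
  obtain ⟨F, hFA, hF, hFε⟩ := hA.exists_isClosed_sdiff_lt
    (measure_ne_top (μH[1].restrict A) A) (ENNReal.coe_ne_zero.2 hε.ne')
  rw [Measure.restrict_apply (hA.diff hF.measurableSet), inter_eq_left.2 sdiff_subset] at hFε
  have hle (k : ι) : μH[1] (range (σ k) ∩ Fᶜ) ≤ μH[1] (range (σ k) \ A) + ε :=
    calc μH[1] (range (σ k) ∩ Fᶜ) ≤ μH[1] (range (σ k) \ A ∪ A \ F) :=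
          measure_mono (sdiff_triangle _ A F)
      _ ≤ μH[1] (range (σ k) \ A) + μH[1] (A \ F) := measure_union_le _ _
      _ ≤ μH[1] (range (σ k) \ A) + ε := by gcongr
  calc μH[1] (range γ \ A) ≤ μH[1] (range γ ∩ Fᶜ) := measure_mono (sdiff_subset_sdiff_right hFA)
    _ ≤ liminf (fun k => μH[1] (range (σ k) ∩ Fᶜ)) u :=
        hausdorffMeasure_range_inter_le_liminf hσ hm hγ hF.isOpen_compl
    _ ≤ liminf (fun k => μH[1] (range (σ k) \ A) + ε) u := liminf_le_liminf (.of_forall hle)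
    _ = liminf (fun k => μH[1] (range (σ k) \ A)) u + ε :=
        liminf_add_const u _ _ (by isBoundedDefault) (by isBoundedDefault)

end LowerSemicontinuityOfLength

section LayerCake

variable {α : Type*} [MeasurableSpace α]

lemma volume_Ioi_zero_inter_setOf_ofReal_lt (c : ℝ≥0∞) :
    volume (Ioi (0 : ℝ) ∩ {t | ENNReal.ofReal t < c}) = c := by
  induction c with
  | top => simp
  | coe c =>
    have hIoo : Ioi (0 : ℝ) ∩ {t | ENNReal.ofReal t < c} = Ioo 0 (c : ℝ) := by
      ext t
      refine and_congr_right fun ht => ?_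
      rw [mem_ofPred_eq, ENNReal.ofReal, ENNReal.coe_lt_coe,
        Real.toNNReal_lt_iff_lt_coe (le_of_lt ht)]
    rw [hIoo, Real.volume_Ioo, sub_zero, ENNReal.ofReal_coe_nnreal]

lemma lintegral_eq_lintegral_meas_ofReal_lt (μ : Measure α) [SFinite μ] {f : α → ℝ≥0∞}
    (hf : Measurable f) :
    ∫⁻ x, f x ∂μ = ∫⁻ t in Ioi (0 : ℝ), μ {x | ENNReal.ofReal t < f x} := by
  let A : Set (α × ℝ) := {p | ENNReal.ofReal p.2 < f p.1}
  have hA : MeasurableSet A :=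
    measurableSet_lt (ENNReal.measurable_ofReal.comp measurable_snd) (hf.comp measurable_fst)
  have hA_fst (x : α) : ∫⁻ t in Ioi (0 : ℝ), A.indicator 1 (x, t) = f x := by
    have hAx : MeasurableSet (Prod.mk x ⁻¹' A) := measurable_prodMk_left hA
    refine (lintegral_indicator_one hAx).trans ?_
    rw [Measure.restrict_apply hAx, inter_comm]
    exact volume_Ioi_zero_inter_setOf_ofReal_lt (f x)
  have hA_snd (t : ℝ) : ∫⁻ x, A.indicator 1 (x, t) ∂μ = μ {x | ENNReal.ofReal t < f x} :=
    lintegral_indicator_one (measurable_prodMk_right hA)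
  calc ∫⁻ x, f x ∂μ = ∫⁻ x, (∫⁻ t in Ioi (0 : ℝ), A.indicator 1 (x, t)) ∂μ := by
        simp only [hA_fst]
    _ = ∫⁻ t in Ioi (0 : ℝ), (∫⁻ x, A.indicator 1 (x, t) ∂μ) :=
        lintegral_lintegral_swap (f := fun x t => A.indicator 1 (x, t))
          (measurable_one.indicator hA).aemeasurable
    _ = ∫⁻ t in Ioi (0 : ℝ), μ {x | ENNReal.ofReal t < f x} := by simp only [hA_snd]

lemma lintegral_le_liminf_lintegral_of_meas_lt {ι : Type*} {u : Filter ι}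
    [u.IsCountablyGenerated] {μ : Measure α} [SFinite μ] {ν : ι → Measure α}
    [∀ k, SFinite (ν k)] {f : α → ℝ≥0∞} (hf : Measurable f)
    (h : ∀ t : ℝ, μ {x | ENNReal.ofReal t < f x} ≤
      liminf (fun k => ν k {x | ENNReal.ofReal t < f x}) u) :
    ∫⁻ x, f x ∂μ ≤ liminf (fun k => ∫⁻ x, f x ∂(ν k)) u := by
  simp only [lintegral_eq_lintegral_meas_ofReal_lt _ hf]
  refine (lintegral_mono h).trans (lintegral_liminf_le fun k => Antitone.measurable ?_)
  exact fun s t hst => measure_mono fun x hx => (ENNReal.ofReal_le_ofReal hst).trans_lt hx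

lemma measure_le_measure_le_one_add_setLIntegral (μ : Measure α) {w : α → ℝ≥0∞}
    (hw : Measurable w) (A : Set α) : μ A ≤ μ {x | w x ≤ 1} + ∫⁻ x in A, w x ∂μ := by
  have hle : MeasurableSet {x | w x ≤ 1} := measurableSet_le hw measurable_const
  have hmarkov : μ (A \ {x | w x ≤ 1}) ≤ ∫⁻ x in A, w x ∂μ :=
    calc μ (A \ {x | w x ≤ 1}) = μ.restrict A {x | w x ≤ 1}ᶜ := by
          rw [Measure.restrict_apply hle.compl, inter_comm, Set.sdiff_eq]
      _ ≤ μ.restrict A {x | 1 ≤ w x} := measure_mono fun x (hx : ¬w x ≤ 1) => (not_le.1 hx).le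
      _ ≤ ∫⁻ x in A, w x ∂μ := by simpa only [one_mul] using mul_meas_ge_le_lintegral hw 1
  exact (measure_le_inter_add_sdiff μ A _).trans
    (add_le_add (measure_mono inter_subset_right) hmarkov)

end LayerCake

section WeightedDist

section MetricSpace

variable {X : Type*} [MetricSpace X] [MeasurableSpace X] [BorelSpace X] {w : X → ℝ≥0∞}

lemma lintegral_range_le_liminf (hw : Measurable w) (hfin : ∀ l < ∞, μH[1] {z | w z ≤ l} < ∞)
    {ι : Type*} {u : Filter ι} [u.NeBot] [u.IsCountablyGenerated] {m : ι → ℝ≥0}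
    {σ : ι → unitInterval → X} {r : ℝ≥0} {γ : unitInterval → X}
    (hσ : ∀ k, IsConstantSpeed (m k) (σ k)) (hm : Tendsto m u (𝓝 r))
    (hγ : ∀ t, Tendsto (fun k => σ k t) u (𝓝 (γ t))) :
    ∫⁻ z in range γ, w z ∂μH[1] ≤ liminf (fun k => ∫⁻ z in range (σ k), w z ∂μH[1]) u := by
  have := isFiniteMeasure_restrict_range
    (lipschitzWith_of_tendsto (fun k => (hσ k).lipschitzWith) hm hγ)
  have (k : ι) := isFiniteMeasure_restrict_range (hσ k).lipschitzWith
  refine lintegral_le_liminf_lintegral_of_meas_lt hw fun t => ?_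
  have hA : MeasurableSet {z | w z ≤ ENNReal.ofReal t} := measurableSet_le hw measurable_const
  have hrestrict (B : Set X) : (μH[1].restrict B) {z | ENNReal.ofReal t < w z} =
      μH[1] (B \ {z | w z ≤ ENNReal.ofReal t}) := by
    rw [Measure.restrict_apply (measurableSet_lt measurable_const hw), inter_comm]
    simp only [Set.sdiff_eq, compl_ofPred, not_le]
  simp only [hrestrict]
  exact hausdorffMeasure_range_sdiff_le_liminf hσ hm hγ hA (hfin _ ENNReal.ofReal_lt_top)

/-- The infimal `w`-weighted length of the image of a Lipschitz curve from `x` to `y`, and `∞` if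
there is no such curve. The urban metric is the case where `w` is `b` on the network `S` and `a`
elsewhere. -/
noncomputable def weightedDist (w : X → ℝ≥0∞) (x y : X) : ℝ≥0∞ :=
  ⨅ (γ : unitInterval → X) (_ : (∃ K, LipschitzWith K γ) ∧ γ 0 = x ∧ γ 1 = y),
    ∫⁻ z in range γ, w z ∂μH[1]

lemma weightedDist_le_lintegral_range {γ : unitInterval → X} {K : ℝ≥0} (hγ : LipschitzWith K γ)
    (w : X → ℝ≥0∞) : weightedDist w (γ 0) (γ 1) ≤ ∫⁻ z in range γ, w z ∂μH[1] :=
  iInf₂_le γ ⟨⟨K, hγ⟩, rfl, rfl⟩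

lemma weightedDist_triangle (w : X → ℝ≥0∞) (x y z : X) :
    weightedDist w x z ≤ weightedDist w x y + weightedDist w y z := by
  refine ENNReal.le_iInf₂_add_iInf₂ ?_
  rintro σ ⟨⟨K, hσ⟩, rfl, hσ1⟩ τ ⟨⟨L, hτ⟩, hτ0, rfl⟩
  obtain ⟨ρ, M, hρ, hρ0, hρ1, hrange⟩ := exists_lipschitzWith_concat hσ hτ (hσ1.trans hτ0.symm)
  calc weightedDist w (σ 0) (τ 1) ≤ ∫⁻ z in range ρ, w z ∂μH[1] :=
        hρ0 ▸ hρ1 ▸ weightedDist_le_lintegral_range hρ w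
    _ ≤ ∫⁻ z in range σ ∪ range τ, w z ∂μH[1] := lintegral_mono_set hrange
    _ ≤ ∫⁻ z in range σ, w z ∂μH[1] + ∫⁻ z in range τ, w z ∂μH[1] := lintegral_union_le _ _ _

lemma exists_isConstantSpeed_lintegral_range_lt {x y : X} {c : ℝ≥0∞}
    (h : weightedDist w x y < c) :
    ∃ σ m, IsConstantSpeed m σ ∧ σ 0 = x ∧ σ 1 = y ∧ ∫⁻ z in range σ, w z ∂μH[1] < c := by
  simp only [weightedDist, iInf_lt_iff] at h
  obtain ⟨γ, ⟨⟨K, hγ⟩, rfl, rfl⟩, hc⟩ := h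
  obtain ⟨σ, m, hσγ, hσ⟩ := exists_isSubcurve_isConstantSpeed hγ
  exact ⟨σ, m, hσ, hσγ.map_zero, hσγ.map_one,
    (lintegral_mono_set hσγ.range_subset).trans_lt hc⟩

lemma weightedDist_le_of_tendsto [ProperSpace X] (hw : Measurable w)
    (hfin : ∀ l < ∞, μH[1] {z | w z ≤ l} < ∞) {c : ℝ≥0∞} (hc : c ≠ ∞) {x y : ℕ → X} {x₀ y₀ : X}
    (hxy : ∀ k, weightedDist w (x k) (y k) < c) (hx : Tendsto x atTop (𝓝 x₀))
    (hy : Tendsto y atTop (𝓝 y₀)) : weightedDist w x₀ y₀ ≤ c := by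
  choose σ m hσ hσx hσy hσc using fun k => exists_isConstantSpeed_lintegral_range_lt (hxy k)
  let M : ℝ≥0 := (μH[1] {z | w z ≤ 1} + c).toNNReal
  have hmM (k : ℕ) : m k ≤ M := by
    refine ENNReal.le_toNNReal_of_coe_le ?_ (by finiteness [hfin 1 ENNReal.one_lt_top])
    calc (m k : ℝ≥0∞) ≤ μH[1] (range (σ k)) := (hσ k).le_hausdorffMeasure
      _ ≤ μH[1] {z | w z ≤ 1} + ∫⁻ z in range (σ k), w z ∂μH[1] :=
          measure_le_measure_le_one_add_setLIntegral _ hw _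
      _ ≤ μH[1] {z | w z ≤ 1} + c := by gcongr; exact (hσc k).le
  obtain ⟨r, γ, φ, hφ, hr, hγ⟩ := exists_subseq_tendsto_of_lipschitzWith_of_tendsto hmM
    (fun k => (hσ k).lipschitzWith) (t₀ := 0) (by simpa only [hσx] using hx)
  have hγL := lipschitzWith_of_tendsto (fun k => (hσ (φ k)).lipschitzWith) hr hγ
  obtain rfl : γ 0 = x₀ := tendsto_nhds_unique (hγ 0) <| by
    simpa only [hσx, Function.comp_def] using hx.comp hφ.tendsto_atTop
  obtain rfl : γ 1 = y₀ := tendsto_nhds_unique (hγ 1) <| by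
    simpa only [hσy, Function.comp_def] using hy.comp hφ.tendsto_atTop
  calc weightedDist w (γ 0) (γ 1) ≤ ∫⁻ z in range γ, w z ∂μH[1] :=
        weightedDist_le_lintegral_range hγL w
    _ ≤ liminf (fun k => ∫⁻ z in range (σ (φ k)), w z ∂μH[1]) atTop :=
        lintegral_range_le_liminf hw hfin (fun k => hσ (φ k)) hr hγ
    _ ≤ c := liminf_le_of_le (by isBoundedDefault) fun b hb =>
        let ⟨k, hk⟩ := hb.exists
        hk.trans (hσc (φ k)).le

lemma lowerSemicontinuous_weightedDist [ProperSpace X] (hw : Measurable w)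
    (hfin : ∀ l < ∞, μH[1] {z | w z ≤ l} < ∞) :
    LowerSemicontinuous fun p : X × X => weightedDist w p.1 p.2 := by
  intro q c hc
  by_contra hfreq
  obtain ⟨d, hcd, hdq⟩ := exists_between hc
  obtain ⟨p, hp, hpc⟩ := exists_seq_forall_of_frequently (not_eventually.1 hfreq)
  exact hdq.not_ge <| weightedDist_le_of_tendsto hw hfin hdq.ne_top
    (fun k => (not_lt.1 (hpc k)).trans_lt hcd) hp.fst_nhds hp.snd_nhds

end MetricSpace

section NormedSpace

variable {V : Type*} [NormedAddCommGroup V] [NormedSpace ℝ V] [MeasurableSpace V] [BorelSpace V]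
  {w : V → ℝ≥0∞} {a : ℝ≥0∞}

lemma weightedDist_le_mul_edist (hw : ∀ z, w z ≤ a) (x y : V) :
    weightedDist w x y ≤ a * edist x y := by
  let γ : unitInterval → V := fun t => AffineMap.lineMap x y (t : ℝ)
  have hγ : LipschitzWith (nndist x y) γ := by
    simpa using! (lipschitzWith_lineMap x y).comp (LipschitzWith.subtype_val (· ∈ unitInterval))
  calc weightedDist w x y = weightedDist w (γ 0) (γ 1) := by simp [γ]
    _ ≤ ∫⁻ z in range γ, w z ∂μH[1] := weightedDist_le_lintegral_range hγ w
    _ ≤ ∫⁻ _ in range γ, a ∂μH[1] := lintegral_mono hw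
    _ = a * μH[1] (range γ) := setLIntegral_const _ _
    _ ≤ a * edist x y := by
        gcongr
        exact edist_nndist x y ▸ hausdorffMeasure_range_le hγ

lemma continuous_weightedDist (hw : ∀ z, w z ≤ a) (ha : a ≠ ∞) :
    Continuous fun p : V × V => weightedDist w p.1 p.2 := by
  refine continuous_of_le_add_edist (2 * a) (by finiteness) fun p q => ?_
  calc weightedDist w p.1 p.2
      ≤ weightedDist w p.1 q.1 + (weightedDist w q.1 q.2 + weightedDist w q.2 p.2) :=
        (weightedDist_triangle w _ q.1 _).trans <| by
          gcongr
          exact weightedDist_triangle w _ _ _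
    _ ≤ a * edist p.1 q.1 + (weightedDist w q.1 q.2 + a * edist q.2 p.2) := by
        gcongr <;> exact weightedDist_le_mul_edist hw _ _
    _ ≤ a * edist p q + (weightedDist w q.1 q.2 + a * edist p q) := by
        rw [edist_comm q.2]
        gcongr
        exacts [le_max_left _ _, le_max_right _ _]
    _ = weightedDist w q.1 q.2 + 2 * a * edist p q := by ring

end NormedSpace

end WeightedDist

section Kantorovich

variable {X Y : Type*} [MeasurableSpace X] [MeasurableSpace Y]

/-- The transport plans between `μ` and `ν` as a subset of the space of probability measures, where
they can be tested for compactness; `transportPlans` consists of bare measures. -/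
def couplings (μ : ProbabilityMeasure X) (ν : ProbabilityMeasure Y) :
    Set (ProbabilityMeasure (X × Y)) :=
  {π | π.map measurable_fst.aemeasurable = μ ∧ π.map measurable_snd.aemeasurable = ν}

lemma couplings_nonempty (μ : ProbabilityMeasure X) (ν : ProbabilityMeasure Y) :
    (couplings μ ν).Nonempty :=
  ⟨μ.prod ν, μ.map_fst_prod ν, μ.map_snd_prod ν⟩

variable [TopologicalSpace X] [BorelSpace X] [TopologicalSpace Y] [BorelSpace Y]

lemma lowerSemicontinuous_lintegral [TopologicalSpace.PseudoMetrizableSpace X]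
    [SecondCountableTopology X] {f : X → ℝ≥0∞} (hf : LowerSemicontinuous f) :
    LowerSemicontinuous fun π : ProbabilityMeasure X => ∫⁻ x, f x ∂(π : Measure X) :=
  fun _ => lowerSemicontinuousAt_iff_le_liminf.2 <|
    lintegral_le_liminf_lintegral_of_meas_lt hf.measurable fun _ =>
      ProbabilityMeasure.le_liminf_measure_open_of_tendsto tendsto_id (hf.isOpen_preimage _)

lemma isClosed_couplings [TopologicalSpace.PseudoMetrizableSpace X] [SecondCountableTopology X]
    [TopologicalSpace.PseudoMetrizableSpace Y] (μ : ProbabilityMeasure X)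
    (ν : ProbabilityMeasure Y) : IsClosed (couplings μ ν) :=
  (isClosed_singleton.preimage (ProbabilityMeasure.continuous_map continuous_fst)).inter
    (isClosed_singleton.preimage (ProbabilityMeasure.continuous_map continuous_snd))

variable [PolishSpace X] [PolishSpace Y]

lemma isCompact_couplings (μ : ProbabilityMeasure X) (ν : ProbabilityMeasure Y) :
    IsCompact (couplings μ ν) := by
  refine (isClosed_couplings μ ν).closure_eq ▸ isCompact_closure_of_isTightMeasureSet ?_
  refine IsTightMeasureSet.prodMk
    ((isTightMeasureSet_singleton (μ := (μ : Measure X))).subset ?_)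
    ((isTightMeasureSet_singleton (μ := (ν : Measure Y))).subset ?_)
  · rintro _ ⟨_, ⟨π, ⟨rfl, -⟩, rfl⟩, rfl⟩
    rfl
  · rintro _ ⟨_, ⟨π, ⟨-, rfl⟩, rfl⟩, rfl⟩
    rfl

lemma exists_isMinOn_couplings {c : X × Y → ℝ≥0∞} (hc : LowerSemicontinuous c)
    (μ : ProbabilityMeasure X) (ν : ProbabilityMeasure Y) :
    ∃ π ∈ couplings μ ν, IsMinOn (fun π : ProbabilityMeasure (X × Y) => ∫⁻ p, c p ∂(π : Measure _))
      (couplings μ ν) π :=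
  LowerSemicontinuousOn.exists_isMinOn (couplings_nonempty μ ν) (isCompact_couplings μ ν)
    ((lowerSemicontinuous_lintegral hc).lowerSemicontinuousOn _)

end Kantorovich

section UrbanMetric

variable {n : ℕ} {S : Set (E n)} {a : ℝ≥0∞} {b : E n → ℝ≥0∞}

open Classical in
/-- The travel cost per unit length: `b` on the network and `a` off it. -/
noncomputable def costDensity (S : Set (E n)) (a : ℝ≥0∞) (b : E n → ℝ≥0∞) : E n → ℝ≥0∞ :=
  S.piecewise b fun _ => a

lemma costDensity_of_mem {z : E n} (hz : z ∈ S) : costDensity S a b z = b z := by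
  classical exact piecewise_eq_of_mem _ _ _ hz

lemma costDensity_of_notMem {z : E n} (hz : z ∉ S) : costDensity S a b z = a := by
  classical exact piecewise_eq_of_notMem _ _ _ hz

lemma costDensity_le (hba : ∀ z ∈ S, b z ≤ a) (z : E n) : costDensity S a b z ≤ a := by
  classical exact piecewise_le (g := fun _ => a) (fun z hz => hba z hz) (fun _ _ => le_rfl) z

lemma setOf_costDensity_le {l : ℝ≥0∞} (hl : l < a) :
    {z | costDensity S a b z ≤ l} = subNetwork S b l := by
  ext z
  by_cases hz : z ∈ S
  · simp [costDensity_of_mem hz, subNetwork, hz]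
  · simp [costDensity_of_notMem hz, subNetwork, hz, hl]

lemma measurable_costDensity (hS : MeasurableSet S) (hb : Measurable (S.domRestrict b)) :
    Measurable (costDensity S a b) := by
  classical
  refine measurable_of_restrict_of_restrict_compl hS ?_ ?_
  · exact (domRestrict_piecewise b (fun _ => a) S).symm ▸ hb
  · exact (domRestrict_piecewise_compl b (fun _ => a) S).symm ▸ measurable_const

lemma pathCost_eq_lintegral_range (hS : MeasurableSet S) (γ : unitInterval → E n) :
    pathCost S a b γ = ∫⁻ z in range γ, costDensity S a b z ∂(H1 n) := by
  rw [← lintegral_inter_add_sdiff _ (range γ) hS, pathCost, ← setLIntegral_const]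
  congr 1
  · exact (lintegral_congr_ae <| (ae_restrict_of_ae_restrict_of_subset inter_subset_right
      (ae_restrict_mem hS)).mono fun z hz => costDensity_of_mem hz).symm
  · exact (lintegral_congr_ae <| (ae_restrict_of_ae_restrict_of_subset (sdiff_subset_compl _ _)
      (ae_restrict_mem hS.compl)).mono fun z hz => costDensity_of_notMem hz).symm

lemma urbanMetric_eq_weightedDist (hS : MeasurableSet S) (x y : E n) :
    urbanMetric S a b x y = weightedDist (costDensity S a b) x y := by
  simp only [urbanMetric, pathCost_eq_lintegral_range hS, weightedDist, lipschitzPaths,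
    mem_ofPred_eq]

lemma lowerSemicontinuous_urbanMetric (hS : MeasurableSet S) (hb : Measurable (S.domRestrict b))
    (hba : ∀ z ∈ S, b z ≤ a) (h : a < ∞ ∨ ∀ l < a, H1 n (subNetwork S b l) < ∞) :
    LowerSemicontinuous fun p : E n × E n => urbanMetric S a b p.1 p.2 := by
  simp only [urbanMetric_eq_weightedDist hS]
  rcases eq_or_ne a ∞ with rfl | ha
  · refine lowerSemicontinuous_weightedDist (measurable_costDensity hS hb) fun l hl => ?_
    exact setOf_costDensity_le hl ▸ h.resolve_left (lt_irrefl _) l hl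
  · exact (continuous_weightedDist (costDensity_le hba) ha).lowerSemicontinuous

end UrbanMetric

end UrbanPlanning

theorem mainTheorem12_general (n : ℕ) (S : Set (UrbanPlanning.E n)) (hSmeas : MeasurableSet S)
    (a : ENNReal) (b : UrbanPlanning.E n → ENNReal) (hb : Measurable (S.domRestrict b))
    (hba : ∀ z ∈ S, b z ≤ a) (μp μm : MeasureTheory.Measure (UrbanPlanning.E n))
    (hμp : MeasureTheory.IsProbabilityMeasure μp) (hμm : MeasureTheory.IsProbabilityMeasure μm)
    (h : a < ⊤ ∨ ∀ l : ENNReal, l < a → UrbanPlanning.H1 n (UrbanPlanning.subNetwork S b l) < ⊤) :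
    ∃ π ∈ UrbanPlanning.transportPlans μp μm,
      UrbanPlanning.wassersteinDist S a b μp μm =
        ∫⁻ p, UrbanPlanning.urbanMetric S a b p.1 p.2 ∂π := by
  obtain ⟨π, hπ, hmin⟩ := UrbanPlanning.exists_isMinOn_couplings
    (UrbanPlanning.lowerSemicontinuous_urbanMetric hSmeas hb hba h) ⟨μp, hμp⟩ ⟨μm, hμm⟩
  have hmem : (π : Measure _) ∈ UrbanPlanning.transportPlans μp μm :=
    ⟨inferInstance, congrArg Subtype.val hπ.1, congrArg Subtype.val hπ.2⟩
  refine ⟨π, hmem, le_antisymm (iInf₂_le _ hmem) (le_iInf₂ ?_)⟩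
  rintro ρ ⟨hρ, hρp, hρm⟩
  exact hmin (a := (⟨ρ, hρ⟩ : ProbabilityMeasure _)) ⟨Subtype.ext hρp, Subtype.ext hρm⟩

theorem mainTheorem12 (n : ℕ) (S : Set (UrbanPlanning.E n)) (hSC : S ⊆ UrbanPlanning.hypercube n)
    (hSmeas : MeasurableSet S) (hSrect : UrbanPlanning.CountablyOneRectifiable S)
    (a : ENNReal) (b : UrbanPlanning.E n → ENNReal)
    (hb : LowerSemicontinuousOn b S) (hba : ∀ z ∈ S, b z ≤ a)
    (μp μm : MeasureTheory.Measure (UrbanPlanning.E n))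
    (hμp : MeasureTheory.IsProbabilityMeasure μp) (hμm : MeasureTheory.IsProbabilityMeasure μm)
    (hμpC : μp (UrbanPlanning.hypercube n)ᶜ = 0) (hμmC : μm (UrbanPlanning.hypercube n)ᶜ = 0)
    (h : a < ⊤ ∨ ∀ l : ENNReal, l < a → UrbanPlanning.H1 n (UrbanPlanning.subNetwork S b l) < ⊤) :
    ∃ π ∈ UrbanPlanning.transportPlans μp μm,
      UrbanPlanning.wassersteinDist S a b μp μm =
        ∫⁻ p, UrbanPlanning.urbanMetric S a b p.1 p.2 ∂π :=
  mainTheorem12_general n S hSmeas a b (lowerSemicontinuous_restrict_iff.2 hb).measurable hba μp μm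
    hμp hμm h
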